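/- Consider finite (possibly empty) sequences $\lambda=(\lambda_1,\dots,\lambda_s)$ of non-negative integers (parts), each of which carries one of the three colors $a,b,u$ and may be overlined or not, subject to the following conditions. Only positive parts may be overlined, and only the final occurrence of a part of a given size and color may be overlined. The last part $\lambda_s$ is none of $0_a,0_b,\overline{1}_a,\overline{1}_b$. For each $i<s$, the difference $\lambda_i-\lambda_{i+1}$ is at least the entry, in the row of the color of $\lambda_i$ and the column of the color of $\lambda_{i+1}$, of the matrix $$\begin{array}{c|cccccc} & \overline a & \overline b & \overline u & a & b & u\\ \hline \overline a & 2&0&2&2&0&2\\ \overline b & 2&2&3&2&2&3\\ \overline u & 1&0&1&1&0&1\\ a & 1&-1&1&1&-1&1\\ b & 1&1&2&1&1&2\\ u & 0&-1&0&0&-1&0\end{array}$$ where an overlined letter refers to an overlined part of that color. These sequences are called jagged overpartitions of $n=\lambda_1+\cdots+\lambda_s$. Let $\overline{C}_3(n;k;i,j)$ be the number of jagged overpartitions of $n$ with exactly $k$ non-overlined parts, $i$ parts colored $a$ and $j$ parts colored $b$, such that the final $t$ parts are all overlined, where $t$ is the number of parts colored $u$. **Theorem.** The numbers $\overline{C}_3(n;k;i,j)$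 are finite, and, as an identity of formal power series in $a,b,q$ with integer coefficients, $$\sum_{n,k,i,j\ge 0}\overline{C}_3(n;k;i,j)\,a^ib^jq^n=\frac{(-q)_\infty(-aq)_\infty(-bq)_\infty}{(abq;q^2)_\infty},$$ where $(x;y)_\infty=\prod_{k\ge0}(1-xy^k)$ and $(x)_\infty=(x;q)_\infty$, and where the sum and the products converge coefficientwise. -/

import Mathlib

open scoped MvPowerSeries.WithPiTopology

namespace Capparelli

/-- The three colors of parts. -/
inductive Color
  | a
  | b
  | u
  deriving DecidableEq

/-- A colored part: a non-negative integer with a color, possibly overlined. -/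
structure Part where
  size : ℕ
  color : Color
  overlined : Bool
  deriving DecidableEq

/-- The entries of the `6 × 6` difference matrix: `minDiff o c c'` is the minimal difference
between a part of color `c` (overlined when `o = true`, non-overlined when `o = false`) and the part
that follows it, of color `c'`.  The entries do not depend on whether the following part is
overlined. -/
def minDiff : Bool → Color → Color → ℤ
  | true, .a, .a => 2
  | true, .a, .b => 0
  | true, .a, .u => 2
  | true, .b, .a => 2
  | true, .b, .b => 2
  | true, .b, .u => 3
  | true, .u, .a => 1
  | true, .u, .b => 0
  | true, .u, .u => 1
  | false, .a, .a => 1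
  | false, .a, .b => -1
  | false, .a, .u => 1
  | false, .b, .a => 1
  | false, .b, .b => 1
  | false, .b, .u => 2
  | false, .u, .a => 0
  | false, .u, .b => -1
  | false, .u, .u => 0

/-- Jagged overpartitions, as finite sequences `(λ₁, …, λₛ)` of colored parts. -/
structure IsJagged (l : List Part) : Prop where
  /-- The difference conditions between successive parts. -/
  diff : l.IsChain fun x y => minDiff x.overlined x.color y.color ≤ (x.size : ℤ) - (y.size : ℤ)
  /-- Only positive parts may be overlined. -/
  pos_of_overlined : ∀ x ∈ l, x.overlined = true → 0 < x.size
  /-- Only the final occurrence of a part (of a given size and color) may be overlined. -/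
  final_of_overlined : l.Pairwise fun x y =>
    x.overlined = true → ¬ (y.size = x.size ∧ y.color = x.color)
  /-- The last part is none of `0_a`, `0_b`, overlined `1_a`, overlined `1_b`. -/
  last : ∀ x ∈ l.getLast?, x ∉
    ([⟨0, .a, false⟩, ⟨0, .b, false⟩, ⟨1, .a, true⟩, ⟨1, .b, true⟩] : List Part)

/-- The number of parts of color `c`. -/
def numColor (c : Color) (l : List Part) : ℕ := l.countP fun x => x.color = c

/-- The number of non-overlined parts. -/
def numNonOverlined (l : List Part) : ℕ := l.countP fun x => x.overlined = false

/-- The final `t` parts are overlined, where `t` is the number of parts of color `u`. -/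
def FinalUOverlined (l : List Part) : Prop :=
  ∀ x ∈ l.drop (l.length - numColor .u l), x.overlined = true

/-- The jagged overpartitions of `n` with `k` non-overlined parts, `i` parts colored `a` and `j`
parts colored `b`, whose final `t` parts are overlined, `t` being the number of `u`-parts. -/
def jaggedSet (n k i j : ℕ) : Set (List Part) :=
  {l | IsJagged l ∧ FinalUOverlined l ∧ (l.map Part.size).sum = n ∧ numNonOverlined l = k ∧
    numColor .a l = i ∧ numColor .b l = j}

/-- The number `C̄₃(n; k; i, j)`. -/
noncomputable def cBar3 (n k i j : ℕ) : ℕ := (jaggedSet n k i j).ncard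

/-- The formal variables of the generating function. -/
inductive Var
  | a
  | b
  | q
  deriving DecidableEq

/-- Formal power series in `a`, `b`, `q` over the integers, carrying (through the scope opened
above) the topology of coefficientwise convergence for the discrete topology of `ℤ`. -/
abbrev Series : Type := MvPowerSeries Var ℤ

noncomputable def a : Series := MvPowerSeries.X Var.a
noncomputable def b : Series := MvPowerSeries.X Var.b
noncomputable def q : Series := MvPowerSeries.X Var.q

/-- `(x; y)_∞ = ∏_{k ≥ 0} (1 - x y ^ k)`. -/
noncomputable def qPochInf (x y : Series) : Series := ∏' k : ℕ, (1 - x * y ^ k)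

/-- The infinite product defining `(x; y)_∞` converges if `y` has no constant term. -/
theorem multipliable_qPochInf (x y : Series) (hy : MvPowerSeries.constantCoeff y = 0) :
    Multipliable fun k : ℕ => (1 - x * y ^ k : Series) := by
  simp_rw [sub_eq_add_neg]
  apply MvPowerSeries.WithPiTopology.multipliable_one_add_of_tendsto_order_atTop_nhds_top
  refine ENat.tendsto_nhds_top_iff_natCast_lt.mpr fun n => Filter.eventually_atTop.mpr ⟨n + 1, ?_⟩
  intro m hm
  rw [MvPowerSeries.order_neg]
  calc (n : ℕ∞) < m := by exact_mod_cast hm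
    _ ≤ (y ^ m).order := MvPowerSeries.le_order_pow_of_constantCoeff_eq_zero m hy
    _ ≤ x.order + (y ^ m).order := le_add_self
    _ ≤ (x * y ^ m).order := MvPowerSeries.le_order_mul

/-- `(x; y)_∞` is an invertible power series if neither `x` nor `y` has a constant term. -/
theorem isUnit_qPochInf (x y : Series) (hx : MvPowerSeries.constantCoeff x = 0)
    (hy : MvPowerSeries.constantCoeff y = 0) : IsUnit (qPochInf x y) := by
  rw [MvPowerSeries.isUnit_iff_constantCoeff]
  have h := (multipliable_qPochInf x y hy).map_tprod (MvPowerSeries.constantCoeff (R := ℤ))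
    (MvPowerSeries.WithPiTopology.continuous_constantCoeff ℤ)
  rw [qPochInf, h]
  simp [hx]

end Capparelli

namespace Capparelli

open Filter Topology Finset

/-! Read a jagged overpartition from its smallest part, preceded by a virtual part `0_a`
(`zeroPart`), which encodes the conditions on the last part. Every part is then determined by its
predecessor, its color, its overline and the excess of its distance over the minimal one, and these
data are arbitrary: the overline condition is automatic (`isJagged_iff`). So `encode` and `decode`
turn jagged overpartitions into free sequences of letters, and an overline just adds 1 to a minimal
difference.

The size splits as `wordSize`, which depends only on the color word, plus `slackSize`, which comes
from overlines and excesses. Let the word have r letters a, s letters b and t letters u. The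
overlines and excesses give q^((r+s)t + t(t+1)/2) (-q)_{r+s} / (q)_{r+s+t} (`hasSum_slackTerm`).
Summing q^wordSize over all such words gives q^(((r-s)^2+r+s)/2) (q)_{r+s+t} (-q)_{r+s} /
((q^2;q^2)_r (q^2;q^2)_s (q)_t) (`hasSum_wordTerm`), by recurrences on the first two letters.

In the product (q)_{r+s+t} cancels. Euler's expansion sums over t and completes one factor
(-q)_{r+s} to (-q)_∞, whatever r and s are. The remaining double series in a and b is
`hasSum_pairTerm`, which follows from a functional equation under x ↦ xq^2. -/

/-! ### Coefficientwise summability: ℤ is discrete, so each coefficient may be nonzero only finitely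
often. -/

theorem summable_iff_finite_coeff {ι : Type*} (f : ι → Series) :
    Summable f ↔ ∀ d, {i | MvPowerSeries.coeff d (f i) ≠ 0}.Finite := by
  rw [MvPowerSeries.WithPiTopology.summable_iff_summable_coeff]
  refine forall_congr' fun d => ⟨fun h => ?_, fun h => summable_of_hasFiniteSupport h⟩
  have h0 := h.tendsto_cofinite_zero
  rw [nhds_discrete, tendsto_pure] at h0
  exact h0

/-- A coefficient of a product involves only the finitely many splittings of its exponent. -/
theorem summable_mul_prod {ι κ : Type*} {f : ι → Series} {g : κ → Series} (hf : Summable f)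
    (hg : Summable g) : Summable fun p : ι × κ => f p.1 * g p.2 := by
  classical
  rw [summable_iff_finite_coeff] at *
  intro d
  refine ((antidiagonal d).finite_toSet.biUnion
    (t := fun x => {i | MvPowerSeries.coeff x.1 (f i) ≠ 0} ×ˢ
      {j | MvPowerSeries.coeff x.2 (g j) ≠ 0})
    fun x _ => (hf x.1).prod (hg x.2)).subset ?_
  rintro ⟨i, j⟩ hij
  simp only [Set.mem_ofPred_eq, MvPowerSeries.coeff_mul] at hij
  obtain ⟨x, hx, hne⟩ := exists_ne_zero_of_sum_ne_zero hij
  exact Set.mem_biUnion (mem_coe.2 hx) ⟨left_ne_zero_of_mul hne, right_ne_zero_of_mul hne⟩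

theorem hasSum_mul_prod {ι κ : Type*} {f : ι → Series} {g : κ → Series} {x y : Series}
    (hf : HasSum f x) (hg : HasSum g y) : HasSum (fun p : ι × κ => f p.1 * g p.2) (x * y) :=
  hf.mul hg (summable_mul_prod hf.summable hg.summable)

theorem summable_of_q_pow_dvd {ι : Type*} {f : ι → Series} (N : ι → ℕ)
    (hN : ∀ n, {i | N i ≤ n}.Finite) (hf : ∀ i, q ^ N i ∣ f i) : Summable f := by
  rw [summable_iff_finite_coeff]
  refine fun d => (hN (d Var.q)).subset fun i hi => ?_
  by_contra! h
  exact hi (MvPowerSeries.X_pow_dvd_iff.1 (hf i) d (by simpa using h))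

theorem q_pow_dvd_of_hasSum {ι : Type*} {f : ι → Series} {x : Series} {n : ℕ}
    (hf : ∀ i, q ^ n ∣ f i) (h : HasSum f x) : q ^ n ∣ x := by
  refine MvPowerSeries.X_pow_dvd_iff.2 fun m hm => ?_
  have := MvPowerSeries.WithPiTopology.hasSum_iff_hasSum_coeff.1 h m
  simp_rw [fun i => MvPowerSeries.X_pow_dvd_iff.1 (hf i) m hm] at this
  exact this.unique hasSum_zero

theorem tendsto_of_q_pow_dvd {x : ℕ → Series} {y : Series} (h : ∀ n, q ^ n ∣ x n - y) :
    Tendsto x atTop (𝓝 y) := by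
  rw [MvPowerSeries.WithPiTopology.tendsto_iff_coeff_tendsto]
  refine fun d => tendsto_const_nhds.congr' ?_
  filter_upwards [eventually_gt_atTop (d Var.q)] with n hn
  have := MvPowerSeries.X_pow_dvd_iff.1 (h n) d hn
  rw [map_sub, sub_eq_zero] at this
  exact this.symm

/-! ### Finite q-Pochhammer symbols and their inverses -/

theorem constantCoeff_q : MvPowerSeries.constantCoeff q = 0 := by simp [q]

theorem isUnit_one_add_q_pow_mul (k : ℕ) (x : Series) : IsUnit (1 + q ^ (k + 1) * x) := by
  rw [MvPowerSeries.isUnit_iff_constantCoeff]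
  simp [constantCoeff_q]

theorem isUnit_one_sub_q_pow (k : ℕ) : IsUnit (1 - q ^ (k + 1)) := by
  simpa [sub_eq_add_neg] using isUnit_one_add_q_pow_mul k (-1)

theorem isUnit_one_add_q_pow (k : ℕ) : IsUnit (1 + q ^ (k + 1)) := by
  simpa using isUnit_one_add_q_pow_mul k 1

/-- `(q; q)_n`. -/
noncomputable def pochQ (n : ℕ) : Series := ∏ k ∈ range n, (1 - q ^ (k + 1))

/-- `(-q; q)_n`. -/
noncomputable def pochNegQ (n : ℕ) : Series := ∏ k ∈ range n, (1 + q ^ (k + 1))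

/-- `1 / (q; q)_n`. -/
noncomputable def invPochQ (n : ℕ) : Series := Ring.inverse (pochQ n)

/-- `1 / (-q; q)_n`. -/
noncomputable def invPochNegQ (n : ℕ) : Series := Ring.inverse (pochNegQ n)

@[simp] theorem pochQ_zero : pochQ 0 = 1 := rfl

@[simp] theorem pochNegQ_zero : pochNegQ 0 = 1 := rfl

theorem pochQ_succ (n : ℕ) : pochQ (n + 1) = pochQ n * (1 - q ^ (n + 1)) := prod_range_succ _ _

theorem pochNegQ_succ (n : ℕ) : pochNegQ (n + 1) = pochNegQ n * (1 + q ^ (n + 1)) :=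
  prod_range_succ _ _

theorem isUnit_pochQ (n : ℕ) : IsUnit (pochQ n) := by
  induction n with
  | zero => simp
  | succ n ih => rw [pochQ_succ]; exact ih.mul (isUnit_one_sub_q_pow n)

theorem isUnit_pochNegQ (n : ℕ) : IsUnit (pochNegQ n) := by
  induction n with
  | zero => simp
  | succ n ih => rw [pochNegQ_succ]; exact ih.mul (isUnit_one_add_q_pow n)

theorem pochQ_mul_inv (n : ℕ) : pochQ n * invPochQ n = 1 :=
  Ring.mul_inverse_cancel _ (isUnit_pochQ n)

theorem pochNegQ_mul_inv (n : ℕ) : pochNegQ n * invPochNegQ n = 1 :=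
  Ring.mul_inverse_cancel _ (isUnit_pochNegQ n)

@[simp] theorem invPochQ_zero : invPochQ 0 = 1 := by simp [invPochQ]

@[simp] theorem invPochNegQ_zero : invPochNegQ 0 = 1 := by simp [invPochNegQ]

theorem invPochQ_succ (n : ℕ) : invPochQ (n + 1) * (1 - q ^ (n + 1)) = invPochQ n := by
  linear_combination (-invPochQ (n + 1) * (1 - q ^ (n + 1))) * pochQ_mul_inv n +
    invPochQ n * pochQ_mul_inv (n + 1) - invPochQ n * invPochQ (n + 1) * pochQ_succ n

theorem invPochNegQ_succ (n : ℕ) : invPochNegQ (n + 1) * (1 + q ^ (n + 1)) = invPochNegQ n := by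
  linear_combination (-invPochNegQ (n + 1) * (1 + q ^ (n + 1))) * pochNegQ_mul_inv n +
    invPochNegQ n * pochNegQ_mul_inv (n + 1) - invPochNegQ n * invPochNegQ (n + 1) * pochNegQ_succ n

/-! ### Euler's expansion -/

theorem tendsto_prod_qPochInf (x y : Series) (hy : MvPowerSeries.constantCoeff y = 0) :
    Tendsto (fun n => ∏ k ∈ range n, (1 - x * y ^ k)) atTop (𝓝 (qPochInf x y)) :=
  (multipliable_qPochInf x y hy).hasProd.tendsto_prod_nat

/-- The terms of Euler's expansion of `(-x q; q)_∞`. -/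
noncomputable def eulerTerm (x : Series) (r : ℕ) : Series :=
  x ^ r * q ^ (r + 1).choose 2 * invPochQ r

theorem self_le_choose_two (r : ℕ) : r ≤ (r + 1).choose 2 := by
  rw [Nat.choose_succ_succ' r 1, Nat.choose_one_right]; omega

theorem summable_eulerTerm (x : Series) : Summable (eulerTerm x) := by
  refine summable_of_q_pow_dvd (fun r => (r + 1).choose 2) (fun n => ?_) fun r => ?_
  · exact (Set.finite_Iic n).subset fun r hr => (self_le_choose_two r).trans hr
  · exact Dvd.intro_left (x ^ r * invPochQ r) (by rw [eulerTerm]; ring)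

/-- Write 1 = q^(r+1) + (1 - q^(r+1)); the second summand cancels the last factor of `pochQ (r +
1)`. Summed over r this is F(x) = (1 + xq) F(xq). -/
theorem eulerTerm_succ (x : Series) (r : ℕ) :
    eulerTerm x (r + 1) = eulerTerm (x * q) (r + 1) + x * q * eulerTerm (x * q) r := by
  simp only [eulerTerm, ← invPochQ_succ r, Nat.choose_succ_succ' (r + 1) 1, Nat.choose_one_right,
    pow_add, mul_pow]
  ring

theorem tsum_eulerTerm (x : Series) :
    ∑' r, eulerTerm x r = (1 + x * q) * ∑' r, eulerTerm (x * q) r := by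
  rw [(summable_eulerTerm x).tsum_eq_zero_add]
  simp_rw [eulerTerm_succ x]
  rw [Summable.tsum_add ((summable_nat_add_iff 1).2 (summable_eulerTerm _))
    ((summable_eulerTerm _).mul_left _), (summable_eulerTerm _).tsum_mul_left,
    (summable_eulerTerm (x * q)).tsum_eq_zero_add]
  simp only [eulerTerm]
  simp
  ring

theorem tsum_eulerTerm_eq_prod_mul (x : Series) (n : ℕ) :
    ∑' r, eulerTerm x r =
      (∏ k ∈ range n, (1 + x * q ^ (k + 1))) * ∑' r, eulerTerm (x * q ^ n) r := by
  induction n with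
  | zero => simp
  | succ n ih =>
    rw [ih, tsum_eulerTerm (x * q ^ n), prod_range_succ, mul_assoc x, ← pow_succ]
    ring

theorem tendsto_tsum_eulerTerm (x : Series) :
    Tendsto (fun n => ∑' r, eulerTerm (x * q ^ n) r) atTop (𝓝 1) := by
  refine tendsto_of_q_pow_dvd fun n => ?_
  rw [(summable_eulerTerm _).tsum_eq_zero_add]
  simp only [eulerTerm, pow_zero, zero_add, Nat.choose_succ_self, invPochQ_zero, mul_one,
    add_sub_cancel_left]
  refine q_pow_dvd_of_hasSum (fun r => ?_)
    ((summable_nat_add_iff 1).2 (summable_eulerTerm (x * q ^ n))).hasSum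
  exact Dvd.intro_left (x * (x * q ^ n) ^ r * q ^ (r + 1 + 1).choose 2 * invPochQ (r + 1))
    (by rw [eulerTerm]; ring)

/-- Euler's expansion of `(-x q; q)_∞`. -/
theorem hasSum_eulerTerm (x : Series) : HasSum (eulerTerm x) (qPochInf (-(x * q)) q) := by
  have h := (tendsto_prod_qPochInf (-(x * q)) q constantCoeff_q).mul (tendsto_tsum_eulerTerm x)
  have h2 : ∀ n, (∏ k ∈ range n, (1 - -(x * q) * q ^ k)) * ∑' r, eulerTerm (x * q ^ n) r =
      ∑' r, eulerTerm x r := fun n => by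
    rw [tsum_eulerTerm_eq_prod_mul x n]
    congr 1
    exact prod_congr rfl fun k _ => by ring
  simp_rw [h2, mul_one] at h
  rw [← tendsto_nhds_unique tendsto_const_nhds h]
  exact (summable_eulerTerm x).hasSum

/-! ### The double series for (-xq)_∞ (-yq)_∞ / (xyq; q^2)_∞ -/

/-- The number `((r - s) ^ 2 + r + s) / 2`. -/
def minExponent : ℕ → ℕ → ℕ
  | 0, s => (s + 1).choose 2
  | r + 1, 0 => (r + 2).choose 2
  | r + 1, s + 1 => minExponent r s + 1

theorem two_mul_choose_two (n : ℕ) : 2 * ((n + 1).choose 2 : ℤ) = n * (n + 1) := by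
  induction n with
  | zero => simp
  | succ n ih =>
    rw [Nat.choose_succ_succ' (n + 1) 1, Nat.choose_one_right]
    push_cast
    linarith

theorem two_mul_minExponent (r s : ℕ) :
    2 * (minExponent r s : ℤ) = ((r : ℤ) - s) ^ 2 + r + s := by
  fun_induction minExponent r s with
  | case1 s => rw [two_mul_choose_two]; push_cast; ring
  | case2 r => rw [two_mul_choose_two]; push_cast; ring
  | case3 r s ih => push_cast; linarith

theorem minExponent_succ_succ (r s : ℕ) : minExponent (r + 1) (s + 1) = minExponent r s + 1 := by
  simp [minExponent]

theorem minExponent_succ_left (r s : ℕ) :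
    minExponent (r + 1) s + s = minExponent r s + r + 1 := by
  have h1 := two_mul_minExponent (r + 1) s
  have h2 := two_mul_minExponent r s
  push_cast at h1
  zify
  linarith

theorem minExponent_succ_right (r s : ℕ) :
    minExponent r (s + 1) + r = minExponent r s + s + 1 := by
  have h1 := two_mul_minExponent r (s + 1)
  have h2 := two_mul_minExponent r s
  push_cast at h1
  zify
  linarith

theorem minExponent_zero_left (s : ℕ) : minExponent 0 s = (s + 1).choose 2 := by
  simp [minExponent]

theorem add_le_two_mul_minExponent (r s : ℕ) : r + s ≤ 2 * minExponent r s := by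
  have := two_mul_minExponent r s
  zify
  nlinarith [sq_nonneg ((r : ℤ) - s)]

/-- `1 / (q ^ 2; q ^ 2)_n`. -/
noncomputable def invPochSq (n : ℕ) : Series := invPochQ n * invPochNegQ n

@[simp] theorem invPochSq_zero : invPochSq 0 = 1 := by simp [invPochSq]

theorem invPochSq_succ (n : ℕ) : invPochSq (n + 1) * (1 - q ^ (2 * n + 2)) = invPochSq n := by
  simp only [invPochSq, ← invPochQ_succ n, ← invPochNegQ_succ n]
  ring

/-- The coefficient of `x ^ r y ^ s` in `(-x q; q)_∞ (-y q; q)_∞ / (x y q; q ^ 2)_∞`. -/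
noncomputable def pairCoeff (r s : ℕ) : Series :=
  q ^ minExponent r s * pochNegQ (r + s) * invPochSq r * invPochSq s

/-- This and the next three recurrences compare the coefficients of x^r y^s in (1 - xyq) F(x) = (1 +
xq)(1 + xq^2) F(xq^2); the cases differ in which shifted coefficients exist. -/
theorem pairCoeff_one_zero : pairCoeff 1 0 * (1 - q ^ 2) = (q + q ^ 2) * pairCoeff 0 0 := by
  have h := invPochSq_succ 0
  simp only [pairCoeff, minExponent, pochNegQ_succ] at *
  simp at *
  linear_combination q * (1 + q) * h

theorem pairCoeff_one_succ (s : ℕ) : pairCoeff 1 (s + 1) * (1 - q ^ 2) =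
    q * pairCoeff 0 s + (q + q ^ 2) * pairCoeff 0 (s + 1) := by
  have h := invPochSq_succ 0
  have e1 : q ^ minExponent 1 (s + 1) = q ^ minExponent 0 s * q := by
    rw [minExponent_succ_succ, pow_succ]
  have e2 : q ^ minExponent 0 (s + 1) = q ^ minExponent 0 s * q ^ (s + 1) := by
    rw [← pow_add]; congr 1; have := minExponent_succ_right 0 s; omega
  simp only [pairCoeff, e1, e2, ← invPochSq_succ s, show 1 + (s + 1) = s + 1 + 1 by ring,
    zero_add, pochNegQ_succ] at *
  simp only [invPochSq_zero] at *
  linear_combination q ^ minExponent 0 s * q * pochNegQ s * (1 + q ^ (s + 1)) *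
    (1 + q ^ (s + 1 + 1)) * invPochSq (s + 1) * h

theorem pairCoeff_add_two_zero (r : ℕ) : pairCoeff (r + 2) 0 * (1 - q ^ (2 * r + 4)) =
    (q + q ^ 2) * q ^ (2 * r + 2) * pairCoeff (r + 1) 0 + q ^ (2 * r + 3) * pairCoeff r 0 := by
  have h := invPochSq_succ (r + 1)
  have e1 : q ^ minExponent (r + 1) 0 = q ^ minExponent r 0 * q ^ (r + 1) := by
    rw [← pow_add]; congr 1; have := minExponent_succ_left r 0; omega
  have e2 : q ^ minExponent (r + 2) 0 = q ^ minExponent r 0 * q ^ (2 * r + 3) := by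
    rw [← pow_add]; congr 1
    have := minExponent_succ_left r 0
    have : minExponent (r + 2) 0 + 0 = minExponent (r + 1) 0 + (r + 1) + 1 :=
      minExponent_succ_left (r + 1) 0
    omega
  simp only [pairCoeff, e1, e2, ← invPochSq_succ r, add_zero, invPochSq_zero, pochNegQ_succ] at *
  linear_combination q ^ minExponent r 0 * q ^ (2 * r + 3) * pochNegQ r * (1 + q ^ (r + 1)) *
    (1 + q ^ (r + 1 + 1)) * h

theorem pairCoeff_add_two_succ (r s : ℕ) :
    pairCoeff (r + 2) (s + 1) * (1 - q ^ (2 * r + 4)) =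
      q * pairCoeff (r + 1) s + (q + q ^ 2) * q ^ (2 * r + 2) * pairCoeff (r + 1) (s + 1) +
        q ^ (2 * r + 3) * pairCoeff r (s + 1) := by
  have h := invPochSq_succ (r + 1)
  have e1 : q ^ minExponent (r + 2) (s + 1) = q ^ minExponent (r + 1) s * q := by
    rw [minExponent_succ_succ, pow_succ]
  have e2 : q ^ minExponent (r + 1) (s + 1) * q ^ (r + 1) =
      q ^ minExponent (r + 1) s * q ^ (s + 1) := by
    rw [← pow_add, ← pow_add]; congr 1; have := minExponent_succ_right (r + 1) s; omega
  have e3 : q ^ minExponent r (s + 1) * q ^ (2 * r + 2) =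
      q ^ minExponent (r + 1) s * q ^ (2 * s + 2) := by
    rw [← pow_add, ← pow_add]; congr 1
    have := minExponent_succ_right (r + 1) s
    have := minExponent_succ_left r (s + 1)
    omega
  simp only [pairCoeff, e1, ← invPochSq_succ r, ← invPochSq_succ s,
    show r + 2 + (s + 1) = r + s + 1 + 1 + 1 by ring, show r + 1 + (s + 1) = r + s + 1 + 1 by ring,
    show r + 1 + s = r + s + 1 by ring, show r + (s + 1) = r + s + 1 by ring,
    pochNegQ_succ (r + s + 1 + 1), pochNegQ_succ (r + s + 1)] at *
  generalize pochNegQ (r + s + 1) = Z at *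
  generalize invPochSq (r + 2) = A at *
  rw [← h]
  generalize invPochSq (s + 1) = B at *
  linear_combination (-(q + q ^ 2) * q ^ (r + 1) * Z * (1 + q ^ (r + s + 1 + 1)) * A *
    (1 - q ^ (2 * (r + 1) + 2)) * B) * e2 - q * (1 - q ^ (2 * r + 2)) * Z * A *
    (1 - q ^ (2 * (r + 1) + 2)) * B * e3

/-- The terms of the expansion of `(-x q; q)_∞ (-y q; q)_∞ / (x y q; q ^ 2)_∞`. -/
noncomputable def pairTerm (x y : Series) (p : ℕ × ℕ) : Series :=
  pairCoeff p.1 p.2 * x ^ p.1 * y ^ p.2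

theorem summable_pairTerm (x y : Series) : Summable (pairTerm x y) := by
  refine summable_of_q_pow_dvd (fun p => minExponent p.1 p.2) (fun n => ?_) fun p => ?_
  · refine (Set.finite_Iic (2 * n, 2 * n)).subset fun p hp => ?_
    have := add_le_two_mul_minExponent p.1 p.2
    simp only [Set.mem_ofPred_eq] at hp
    exact Prod.mk_le_mk.2 ⟨by omega, by omega⟩
  · exact Dvd.intro (pochNegQ (p.1 + p.2) * invPochSq p.1 * invPochSq p.2 * x ^ p.1 * y ^ p.2)
      (by rw [pairTerm, pairCoeff]; ring)

/-- The shift of a doubly indexed family in the first index. -/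
noncomputable def shiftLeft (f : ℕ × ℕ → Series) : ℕ × ℕ → Series
  | (0, _) => 0
  | (r + 1, s) => f (r, s)

/-- The shift of a doubly indexed family in the second index. -/
noncomputable def shiftRight (f : ℕ × ℕ → Series) : ℕ × ℕ → Series
  | (_, 0) => 0
  | (r, s + 1) => f (r, s)

theorem hasSum_shiftLeft {f : ℕ × ℕ → Series} {v : Series} (h : HasSum f v) :
    HasSum (shiftLeft f) v := by
  have hi : Function.Injective fun p : ℕ × ℕ => (p.1 + 1, p.2) := fun p p' hp => by
    simpa [Prod.ext_iff] using hp
  refine (hi.hasSum_iff ?_).1 h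
  rintro ⟨_ | r, s⟩ hx
  · rfl
  · exact absurd ⟨(r, s), rfl⟩ hx

theorem hasSum_shiftRight {f : ℕ × ℕ → Series} {v : Series} (h : HasSum f v) :
    HasSum (shiftRight f) v := by
  have hi : Function.Injective fun p : ℕ × ℕ => (p.1, p.2 + 1) := fun p p' hp => by
    simpa [Prod.ext_iff] using hp
  refine (hi.hasSum_iff ?_).1 h
  rintro ⟨r, _ | s⟩ hx
  · rfl
  · exact absurd ⟨(r, s), rfl⟩ hx

theorem pairTerm_recurrence (x y : Series) (p : ℕ × ℕ) :
    pairTerm x y p = pairTerm (x * q ^ 2) y p +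
      (q * x * y * shiftLeft (shiftRight (pairTerm x y)) p +
        (q + q ^ 2) * x * shiftLeft (pairTerm (x * q ^ 2) y) p +
        q ^ 3 * x ^ 2 * shiftLeft (shiftLeft (pairTerm (x * q ^ 2) y)) p) := by
  obtain ⟨_ | _ | r, _ | s⟩ := p
  · simp [shiftLeft, pairTerm]
  · simp [shiftLeft, pairTerm]
  · simp only [shiftLeft, shiftRight, pairTerm]
    linear_combination x * pairCoeff_one_zero
  · simp only [shiftLeft, shiftRight, pairTerm]
    linear_combination x * y ^ (s + 1) * pairCoeff_one_succ s
  · simp only [shiftLeft, shiftRight, pairTerm]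
    linear_combination x ^ (r + 2) * pairCoeff_add_two_zero r
  · simp only [shiftLeft, shiftRight, pairTerm]
    linear_combination x ^ (r + 2) * y ^ (s + 1) * pairCoeff_add_two_succ r s

theorem one_sub_mul_tsum_pairTerm (x y : Series) :
    (1 - x * y * q) * ∑' p, pairTerm x y p =
      (1 + x * q) * (1 + x * q ^ 2) * ∑' p, pairTerm (x * q ^ 2) y p := by
  have h1 := (summable_pairTerm x y).hasSum
  have h2 := (summable_pairTerm (x * q ^ 2) y).hasSum
  have h := h2.add ((((hasSum_shiftLeft (hasSum_shiftRight h1)).mul_left (q * x * y)).add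
    ((hasSum_shiftLeft h2).mul_left ((q + q ^ 2) * x))).add
    ((hasSum_shiftLeft (hasSum_shiftLeft h2)).mul_left (q ^ 3 * x ^ 2)))
  simp_rw [← pairTerm_recurrence] at h
  linear_combination h1.unique h

/-- Each step x ↦ xq^2 releases one factor of (xyq; q^2)_∞ but two of (-xq; q)_∞, hence the ranges n
and 2n. -/
theorem prod_mul_tsum_pairTerm (x y : Series) (n : ℕ) :
    (∏ k ∈ range n, (1 - x * y * q * (q ^ 2) ^ k)) * ∑' p, pairTerm x y p =
      (∏ k ∈ range (2 * n), (1 - -(x * q) * q ^ k)) *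
        ∑' p, pairTerm (x * q ^ (2 * n)) y p := by
  induction n with
  | zero => simp
  | succ n ih =>
    have h := one_sub_mul_tsum_pairTerm (x * q ^ (2 * n)) y
    rw [show x * q ^ (2 * (n + 1)) = x * q ^ (2 * n) * q ^ 2 by ring,
      show 2 * (n + 1) = 2 * n + 1 + 1 by ring, prod_range_succ, prod_range_succ, prod_range_succ]
    linear_combination (1 - x * y * q * (q ^ 2) ^ n) * ih +
      (∏ k ∈ range (2 * n), (1 - -(x * q) * q ^ k)) * h

theorem pairCoeff_zero_left (s : ℕ) : pairCoeff 0 s = q ^ (s + 1).choose 2 * invPochQ s := by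
  rw [pairCoeff, minExponent_zero_left, invPochSq, invPochSq, zero_add]
  simp only [invPochQ_zero, invPochNegQ_zero]
  linear_combination q ^ (s + 1).choose 2 * invPochQ s * pochNegQ_mul_inv s

theorem hasSum_pairTerm_zero (y : Series) :
    HasSum (pairTerm 0 y) (qPochInf (-(y * q)) q) := by
  have hi : Function.Injective fun s : ℕ => (0, s) := fun s s' h => by simpa using h
  refine (hi.hasSum_iff ?_).1 ?_
  · rintro ⟨_ | r, s⟩ h
    · exact absurd ⟨s, rfl⟩ h
    · simp [pairTerm]
  · convert hasSum_eulerTerm y using 1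
    funext s
    simp only [Function.comp, pairTerm, eulerTerm, pairCoeff_zero_left]
    ring

/-- Since xq^(2n) tends to 0, only the terms with r = 0 survive, and these form Euler's series in y.
-/
theorem tendsto_tsum_pairTerm (x y : Series) :
    Tendsto (fun n => ∑' p, pairTerm (x * q ^ (2 * n)) y p) atTop
      (𝓝 (qPochInf (-(y * q)) q)) := by
  refine tendsto_of_q_pow_dvd fun n => ?_
  refine q_pow_dvd_of_hasSum (fun p => ?_)
    ((summable_pairTerm (x * q ^ (2 * n)) y).hasSum.sub (hasSum_pairTerm_zero y))
  have h := sub_dvd_pow_sub_pow (x * q ^ (2 * n)) 0 p.1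
  have h' : q ^ n ∣ x * q ^ (2 * n) - 0 := Dvd.intro (x * q ^ n) (by ring)
  simp only [pairTerm]
  rw [← sub_mul, ← mul_sub]
  exact ((h'.trans h).mul_left _).mul_right _

theorem qPochInf_mul_tsum_pairTerm (x y : Series) :
    qPochInf (x * y * q) (q ^ 2) * ∑' p, pairTerm x y p =
      qPochInf (-(x * q)) q * qPochInf (-(y * q)) q := by
  have hq2 : MvPowerSeries.constantCoeff (q ^ 2) = 0 := by simp [constantCoeff_q]
  have h1 := (tendsto_prod_qPochInf (x * y * q) (q ^ 2) hq2).mul_const (∑' p, pairTerm x y p)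
  have h2 := ((tendsto_prod_qPochInf (-(x * q)) q constantCoeff_q).comp
    (tendsto_id.const_mul_atTop' (two_pos : 0 < 2))).mul (tendsto_tsum_pairTerm x y)
  simp_rw [prod_mul_tsum_pairTerm] at h1
  exact tendsto_nhds_unique h1 h2

theorem hasSum_pairTerm (x y : Series) :
    HasSum (pairTerm x y) (qPochInf (-(x * q)) q * qPochInf (-(y * q)) q *
      Ring.inverse (qPochInf (x * y * q) (q ^ 2))) := by
  have hu : IsUnit (qPochInf (x * y * q) (q ^ 2)) :=
    isUnit_qPochInf _ _ (by simp [constantCoeff_q]) (by simp [constantCoeff_q])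
  rw [← qPochInf_mul_tsum_pairTerm, mul_comm, ← mul_assoc, Ring.inverse_mul_cancel _ hu, one_mul]
  exact (summable_pairTerm x y).hasSum

/-! ### Minimal sizes of color words -/

/-- The size of the minimal non-overlined sequence with colors `w`, read from the smallest part, if
all the parts are raised by the minimal distance from a preceding part `0` of color `y`. -/
def wordSize : Color → List Color → ℤ
  | _, [] => 0
  | y, c :: w => (w.length + 1) * minDiff false c y + wordSize c w

theorem wordSize_a_cons (w : List Color) :
    wordSize .a (.a :: w) = wordSize .a w + (w.length + 1) := by
  simp only [wordSize, minDiff]; ring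

/-- The step up to b (+1) and the step back to a (-1) cancel for every part but the b itself. The
other two-letter rules likewise compare the differences from b or u with those from a, so that the
base color is always a. -/
theorem wordSize_b_a_cons (w : List Color) :
    wordSize .a (.b :: .a :: w) = wordSize .a w + 1 := by
  simp only [wordSize, minDiff, List.length_cons]; push_cast; ring

theorem wordSize_b_b_cons (w : List Color) :
    wordSize .a (.b :: .b :: w) = wordSize .a (.b :: w) + (w.length + 1) + 1 := by
  simp only [wordSize, minDiff, List.length_cons]; push_cast; ring

theorem wordSize_b_u_cons (w : List Color) :
    wordSize .a (.b :: .u :: w) = wordSize .a (.u :: w) + 1 := by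
  simp only [wordSize, minDiff, List.length_cons]; push_cast; ring

theorem wordSize_u_a_cons (w : List Color) :
    wordSize .a (.u :: .a :: w) = wordSize .a (.a :: w) := by
  simp only [wordSize, minDiff, List.length_cons]; push_cast; ring

theorem wordSize_u_b_cons (w : List Color) :
    wordSize .a (.u :: .b :: w) = wordSize .a (.b :: w) + (w.length + 1) := by
  simp only [wordSize, minDiff, List.length_cons]; push_cast; ring

theorem wordSize_u_u_cons (w : List Color) :
    wordSize .a (.u :: .u :: w) = wordSize .a (.u :: w) := by
  simp only [wordSize, minDiff, List.length_cons]; push_cast; ring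

theorem wordSize_nonneg : ∀ w : List Color, 0 ≤ wordSize .a w
  | [] => by simp [wordSize]
  | .a :: w => by rw [wordSize_a_cons]; have := wordSize_nonneg w; positivity
  | [.b] => by simp [wordSize, minDiff]
  | .b :: .a :: w => by rw [wordSize_b_a_cons]; have := wordSize_nonneg w; positivity
  | .b :: .b :: w => by rw [wordSize_b_b_cons]; have := wordSize_nonneg (.b :: w); positivity
  | .b :: .u :: w => by rw [wordSize_b_u_cons]; have := wordSize_nonneg (.u :: w); positivity
  | [.u] => by simp [wordSize, minDiff]
  | .u :: .a :: w => by rw [wordSize_u_a_cons]; exact wordSize_nonneg (.a :: w)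
  | .u :: .b :: w => by rw [wordSize_u_b_cons]; have := wordSize_nonneg (.b :: w); positivity
  | .u :: .u :: w => by rw [wordSize_u_u_cons]; exact wordSize_nonneg (.u :: w)

/-- The power `q ^ wordSize .a w`. -/
noncomputable def wordPow (w : List Color) : Series := q ^ (wordSize .a w).toNat

theorem wordPow_of_eq_add {w v : List Color} {k : ℕ} (h : wordSize .a w = wordSize .a v + k) :
    wordPow w = q ^ k * wordPow v := by
  rw [wordPow, wordPow, ← pow_add]
  congr 1
  have := wordSize_nonneg v
  omega

/-- The word `w` has `r` letters `a`, `s` letters `b` and `t` letters `u`. -/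
def HasCounts (r s t : ℕ) (w : List Color) : Prop :=
  w.count .a = r ∧ w.count .b = s ∧ w.count .u = t

instance (r s t : ℕ) : DecidablePred (HasCounts r s t) := fun w => by
  unfold HasCounts; infer_instance

theorem length_eq_count_add (w : List Color) :
    w.length = w.count .a + w.count .b + w.count .u := by
  induction w with
  | nil => simp
  | cons c w ih => cases c <;> simp [ih] <;> ring

theorem HasCounts.length_eq {r s t : ℕ} {w : List Color} (h : HasCounts r s t w) :
    w.length = r + s + t := by
  rw [length_eq_count_add, h.1, h.2.1, h.2.2]

theorem hasCounts_a_cons (r s t : ℕ) (w : List Color) :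
    HasCounts (r + 1) s t (.a :: w) ↔ HasCounts r s t w := by
  simp [HasCounts]

theorem hasCounts_b_cons (r s t : ℕ) (w : List Color) :
    HasCounts r (s + 1) t (.b :: w) ↔ HasCounts r s t w := by
  simp [HasCounts]

theorem hasCounts_u_cons (r s t : ℕ) (w : List Color) :
    HasCounts r s (t + 1) (.u :: w) ↔ HasCounts r s t w := by
  simp [HasCounts]

theorem not_hasCounts_a_cons (s t : ℕ) (w : List Color) : ¬ HasCounts 0 s t (.a :: w) := by
  simp [HasCounts]

theorem not_hasCounts_b_cons (r t : ℕ) (w : List Color) : ¬ HasCounts r 0 t (.b :: w) := by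
  simp [HasCounts]

theorem not_hasCounts_u_cons (r s : ℕ) (w : List Color) : ¬ HasCounts r s 0 (.u :: w) := by
  simp [HasCounts]

/-- `q ^ wordSize .a w` for words with the given numbers of letters, and `0` for all others. -/
noncomputable def wordTerm (r s t : ℕ) (w : List Color) : Series :=
  if HasCounts r s t w then wordPow w else 0

theorem wordTerm_eq_mul {r s t r' s' t' k : ℕ} {w v : List Color}
    (hc : HasCounts r s t w ↔ HasCounts r' s' t' v)
    (h : HasCounts r' s' t' v → wordSize .a w = wordSize .a v + k) :
    wordTerm r s t w = q ^ k * wordTerm r' s' t' v := by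
  unfold wordTerm
  by_cases hv : HasCounts r' s' t' v
  · rw [if_pos hv, if_pos (hc.2 hv), wordPow_of_eq_add (h hv)]
  · rw [if_neg hv, if_neg (mt hc.1 hv), mul_zero]

theorem wordTerm_a_cons (r s t : ℕ) (w : List Color) :
    wordTerm (r + 1) s t (.a :: w) = q ^ (r + s + t + 1) * wordTerm r s t w :=
  wordTerm_eq_mul (hasCounts_a_cons r s t w) fun h => by
    rw [wordSize_a_cons, h.length_eq]; push_cast; ring

theorem wordTerm_b_a_cons (r s t : ℕ) (w : List Color) :
    wordTerm (r + 1) (s + 1) t (.b :: .a :: w) = q ^ 1 * wordTerm r s t w :=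
  wordTerm_eq_mul ((hasCounts_b_cons _ _ _ _).trans (hasCounts_a_cons r s t w)) fun _ => by
    rw [wordSize_b_a_cons]; rfl

theorem wordTerm_b_b_cons (r s t : ℕ) (w : List Color) :
    wordTerm r (s + 1) t (.b :: .b :: w) = q ^ (r + s + t + 1) * wordTerm r s t (.b :: w) :=
  wordTerm_eq_mul (hasCounts_b_cons _ _ _ _) fun h => by
    have := h.length_eq
    rw [List.length_cons] at this
    rw [wordSize_b_b_cons, ← this]; push_cast; ring

theorem wordTerm_b_u_cons (r s t : ℕ) (w : List Color) :
    wordTerm r (s + 1) t (.b :: .u :: w) = q ^ 1 * wordTerm r s t (.u :: w) :=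
  wordTerm_eq_mul (hasCounts_b_cons _ _ _ _) fun _ => by rw [wordSize_b_u_cons]; rfl

theorem wordTerm_u_a_cons (r s t : ℕ) (w : List Color) :
    wordTerm r s (t + 1) (.u :: .a :: w) = q ^ 0 * wordTerm r s t (.a :: w) :=
  wordTerm_eq_mul (hasCounts_u_cons _ _ _ _) fun _ => by rw [wordSize_u_a_cons]; simp

theorem wordTerm_u_b_cons (r s t : ℕ) (w : List Color) :
    wordTerm r s (t + 1) (.u :: .b :: w) = q ^ (r + s + t) * wordTerm r s t (.b :: w) :=
  wordTerm_eq_mul (hasCounts_u_cons _ _ _ _) fun h => by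
    have := h.length_eq
    rw [List.length_cons] at this
    rw [wordSize_u_b_cons, ← this]; push_cast; ring

theorem wordTerm_u_u_cons (r s t : ℕ) (w : List Color) :
    wordTerm r s (t + 1) (.u :: .u :: w) = q ^ 0 * wordTerm r s t (.u :: w) :=
  wordTerm_eq_mul (hasCounts_u_cons _ _ _ _) fun _ => by rw [wordSize_u_u_cons]; simp

/-- A sum over words is split according to the first letter. -/
theorem hasSum_of_cons {f : List Color → Series} {x y z : Series}
    (ha : HasSum (fun w => f (.a :: w)) x) (hb : HasSum (fun w => f (.b :: w)) y)
    (hu : HasSum (fun w => f (.u :: w)) z) : HasSum f (f [] + x + y + z) := by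
  have key : ∀ (c : Color) (v : Series), HasSum (fun w => f (c :: w)) v →
      HasSum (fun w => if w.head? = some c then f w else 0) v := fun c v h => by
    refine ((List.cons_injective (a := c)).hasSum_iff ?_).1 (by simpa [Function.comp_def] using h)
    rintro (_ | ⟨c', w⟩) hw
    · simp
    · rw [if_neg]
      rintro h'
      simp only [List.head?_cons, Option.some.injEq] at h'
      exact hw ⟨w, by rw [h']⟩
  have h0 : HasSum (fun w : List Color => if w = [] then f [] else 0) (f []) := hasSum_ite_eq [] (f [])
  refine (((h0.add (key _ _ ha)).add (key _ _ hb)).add (key _ _ hu)).congr_fun ?_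
  rintro (_ | ⟨_ | _ | _, w⟩) <;> simp

/-! ### Closed forms for the sums over words -/

/-- The closed form of the sum of `wordTerm r s t`. -/
noncomputable def wordSum (r s t : ℕ) : Series :=
  q ^ minExponent r s * pochQ (r + s + t) * pochNegQ (r + s) * invPochSq r * invPochSq s *
    invPochQ t

/-- The closed form of the sum of `wordTerm r s t` over the words starting with `a`. -/
noncomputable def wordSumA : ℕ → ℕ → ℕ → Series
  | 0, _, _ => 0
  | r + 1, s, t => q ^ (r + s + t + 1) * wordSum r s t

/-- The closed form of the sum of `wordTerm r s t` over the words starting with `b`. -/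
noncomputable def wordSumB : ℕ → ℕ → ℕ → Series
  | _, 0, _ => 0
  | r, s + 1, t => q ^ minExponent r (s + 1) * pochQ (r + s + t) * pochNegQ (r + s) *
      invPochSq r * invPochSq s * invPochQ t

/-- Recurrence for words starting with u: removing that u costs nothing unless a b follows, which
brings in q^(r+s+t). The left side is the u-part as a difference. -/
theorem wordSum_succ_right (r s t : ℕ) :
    wordSum r s (t + 1) - wordSumA r s (t + 1) - wordSumB r s (t + 1) =
      wordSum r s t + (q ^ (r + s + t) - 1) * wordSumB r s t := by
  have ht : ∀ n : ℕ, n + 1 + t = n + t + 1 := fun n => add_right_comm n 1 t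
  have hs : ∀ n s : ℕ, n + 1 + s = n + s + 1 := fun n s => add_right_comm n 1 s
  obtain _ | r := r <;> obtain _ | s := s
  · simp only [← add_assoc, zero_add, add_zero, wordSumA, wordSumB, wordSum, ← invPochQ_succ t]
    simp only [pochQ_succ]
    ring
  · simp only [← add_assoc, zero_add, ht, wordSumA, wordSumB, wordSum, ← invPochQ_succ t, ← invPochSq_succ s,
      pochQ_succ (s + t + 1), pochQ_succ (s + t), pochNegQ_succ s]
    ring
  · have e1 : q ^ minExponent (r + 1) 0 = q ^ minExponent r 0 * q ^ (r + 1) := by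
      rw [← pow_add]; congr 1; have := minExponent_succ_left r 0; omega
    simp only [← add_assoc, add_zero, ht, wordSumA, wordSumB, wordSum, ← invPochQ_succ t, ← invPochSq_succ r, e1,
      pochQ_succ (r + t + 1), pochQ_succ (r + t), pochNegQ_succ r]
    ring
  · have e1 : q ^ minExponent (r + 1) (s + 1) = q ^ minExponent r s * q := by
      rw [minExponent_succ_succ, pow_succ]
    have e2 : q ^ minExponent r (s + 1) * q ^ r = q ^ minExponent r s * q ^ (s + 1) := by
      rw [← pow_add, ← pow_add]; congr 1; have := minExponent_succ_right r s; omega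
    simp only [← add_assoc, ht, hs _ s, wordSumA, wordSumB, wordSum, ← invPochQ_succ t, ← invPochSq_succ r,
      ← invPochSq_succ s, e1,
      pochQ_succ (r + s + t + 1 + 1), pochQ_succ (r + s + t + 1), pochNegQ_succ (r + s + 1)]
    generalize pochQ (r + s + t + 1) = P
    generalize pochNegQ (r + s + 1) = Z
    generalize invPochSq (r + 1) = A
    generalize invPochSq (s + 1) = B
    generalize invPochQ (t + 1) = C
    linear_combination (-q ^ (s + t + 3) * P * (1 - q ^ (r + s + t + 1 + 1)) * Z * A *
      (1 - q ^ (2 * r + 2)) * B * C) * e2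

theorem wordSumB_succ_zero (s t : ℕ) :
    wordSumB 0 (s + 1) t = q ^ (s + t + 1) * wordSumB 0 s t +
      q * (wordSum 0 s t - wordSumA 0 s t - wordSumB 0 s t) := by
  have ht : ∀ n : ℕ, n + 1 + t = n + t + 1 := fun n => add_right_comm n 1 t
  have hs : ∀ n s : ℕ, n + 1 + s = n + s + 1 := fun n s => add_right_comm n 1 s
  obtain _ | s := s
  · simp [wordSumA, wordSumB, wordSum, minExponent, mul_assoc]
  · have e2 : q ^ minExponent 0 (s + 1 + 1) = q ^ minExponent 0 (s + 1) * q ^ (s + 2) := by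
      rw [← pow_add]; congr 1; have := minExponent_succ_right 0 (s + 1); omega
    simp only [← add_assoc, zero_add, ht, wordSumA, wordSumB, wordSum, ← invPochSq_succ s, e2,
      pochQ_succ (s + t), pochNegQ_succ s]
    ring

/-- The three terms are the words starting with ba, with bb, and with bu together with the
one-letter word b; the last difference is the sum over words that are empty or start with u. -/
theorem wordSumB_succ_succ (r s t : ℕ) :
    wordSumB (r + 1) (s + 1) t = q * wordSum r s t +
      q ^ (r + 1 + s + t + 1) * wordSumB (r + 1) s t +
      q * (wordSum (r + 1) s t - wordSumA (r + 1) s t - wordSumB (r + 1) s t) := by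
  have ht : ∀ n : ℕ, n + 1 + t = n + t + 1 := fun n => add_right_comm n 1 t
  have hs : ∀ n s : ℕ, n + 1 + s = n + s + 1 := fun n s => add_right_comm n 1 s
  have e1 : q ^ minExponent (r + 1) (s + 1) = q ^ minExponent r s * q := by
    rw [minExponent_succ_succ, pow_succ]
  obtain _ | s := s
  · have e2 : q ^ minExponent (r + 1) 0 = q ^ minExponent r 0 * q ^ (r + 1) := by
      rw [← pow_add]; congr 1; have := minExponent_succ_left r 0; omega
    simp only [zero_add, add_zero, ht, wordSumA, wordSumB, wordSum, ← invPochSq_succ r, e1, e2,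
      pochQ_succ (r + t), pochNegQ_succ r]
    ring
  · have e2 : q ^ minExponent r (s + 1) * q ^ r = q ^ minExponent r s * q ^ (s + 1) := by
      rw [← pow_add, ← pow_add]; congr 1; have := minExponent_succ_right r s; omega
    have e4 : q ^ minExponent (r + 1) (s + 1) = q ^ minExponent r s * q := by
      rw [minExponent_succ_succ, pow_succ]
    have e3 : q ^ minExponent (r + 1) (s + 1 + 1) = q ^ minExponent r (s + 1) * q := by
      rw [minExponent_succ_succ, pow_succ]
    simp only [← add_assoc, ht, hs _ s, wordSumA, wordSumB, wordSum, ← invPochSq_succ r, ← invPochSq_succ s, e4, e3,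
      pochQ_succ (r + s + t + 1), pochNegQ_succ (r + s + 1)]
    generalize pochQ (r + s + t + 1) = P
    generalize pochNegQ (r + s + 1) = Z
    generalize invPochSq (r + 1) = A
    generalize invPochSq (s + 1) = B
    generalize invPochQ t = C
    linear_combination q * P * Z * A * B * C * (1 - q ^ (r + s + t + 2)) *
      (q ^ (s + 2) + q ^ (r + 2)) * e2

theorem wordSum_zero_right (r s : ℕ) :
    wordSum r s 0 - wordSumA r s 0 - wordSumB r s 0 = if r = 0 ∧ s = 0 then 1 else 0 := by
  have hs : ∀ n s : ℕ, n + 1 + s = n + s + 1 := fun n s => add_right_comm n 1 s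
  obtain _ | r := r <;> obtain _ | s := s
  · simp [wordSumA, wordSumB, wordSum, minExponent]
  · simp only [← add_assoc, zero_add, add_zero, wordSumA, wordSumB, wordSum, ← invPochSq_succ s,
      add_zero, zero_add,
      pochQ_succ s, pochNegQ_succ s]
    simp
    ring
  · have e1 : q ^ minExponent (r + 1) 0 = q ^ minExponent r 0 * q ^ (r + 1) := by
      rw [← pow_add]; congr 1; have := minExponent_succ_left r 0; omega
    simp only [add_zero, wordSumA, wordSumB, wordSum, ← invPochSq_succ r, e1, add_zero,
      pochQ_succ r, pochNegQ_succ r]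
    simp
    ring
  · have e1 : q ^ minExponent (r + 1) (s + 1) = q ^ minExponent r s * q := by
      rw [minExponent_succ_succ, pow_succ]
    have e2 : q ^ minExponent r (s + 1) * q ^ r = q ^ minExponent r s * q ^ (s + 1) := by
      rw [← pow_add, ← pow_add]; congr 1; have := minExponent_succ_right r s; omega
    rw [if_neg (by simp)]
    simp only [← add_assoc, add_zero, hs _ s, wordSumA, wordSumB, wordSum, ← invPochSq_succ r, ← invPochSq_succ s, e1,
      add_zero,
      pochQ_succ (r + s + 1), pochNegQ_succ (r + s + 1)]
    generalize pochQ (r + s + 1) = P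
    generalize pochNegQ (r + s + 1) = Z
    generalize invPochSq (r + 1) = A
    generalize invPochSq (s + 1) = B
    linear_combination (-q ^ (s + 2) * P * Z * A * (1 - q ^ (2 * r + 2)) * B * invPochQ 0) * e2

theorem wordTerm_nil (r s t : ℕ) :
    wordTerm r s t [] = if r = 0 ∧ s = 0 ∧ t = 0 then 1 else 0 := by
  simp [wordTerm, HasCounts, wordPow, wordSize, eq_comm]

/-- The closed form of the sum of `wordTerm r s t` over the words starting with `u`. -/
noncomputable def wordSumU (r s t : ℕ) : Series :=
  wordSum r s t - wordSumA r s t - wordSumB r s t - wordTerm r s t []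

/-- The three first letters are treated together because each recurrence on the first two letters
mixes the sums for shorter words. -/
theorem hasSum_wordTerm_cons (n : ℕ) : ∀ r s t, r + s + t = n →
    HasSum (fun w => wordTerm r s t (.a :: w)) (wordSumA r s t) ∧
    HasSum (fun w => wordTerm r s t (.b :: w)) (wordSumB r s t) ∧
    HasSum (fun w => wordTerm r s t (.u :: w)) (wordSumU r s t) := by
  induction n using Nat.strong_induction_on with
  | _ n ih =>
    rintro r s t hn
    have total : ∀ r' s' t', r' + s' + t' < n →
        HasSum (wordTerm r' s' t') (wordSum r' s' t') := fun r' s' t' h => by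
      obtain ⟨ha, hb, hu⟩ := ih _ h r' s' t' rfl
      convert hasSum_of_cons ha hb hu using 1
      rw [wordSumU]; ring
    refine ⟨?_, ?_, ?_⟩
    · obtain _ | r := r
      · simp only [wordTerm, if_neg (not_hasCounts_a_cons _ _ _)]
        exact hasSum_zero
      · simp_rw [wordTerm_a_cons]
        exact (total r s t (by omega)).mul_left _
    · obtain _ | s := s
      · simp only [wordTerm, if_neg (not_hasCounts_b_cons _ _ _)]
        exact hasSum_zero
      · obtain ⟨-, hb, hu⟩ := ih (r + s + t) (by omega) r s t rfl
        have hnil : wordTerm r (s + 1) t [.b] = q * wordTerm r s t [] := by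
          have := wordTerm_eq_mul (k := 1) (hasCounts_b_cons r s t []) fun _ => rfl
          rwa [pow_one] at this
        obtain _ | r := r
        -- With no letter a available, the words starting with ba contribute nothing.
        · have h := hasSum_of_cons (f := fun w => wordTerm 0 (s + 1) t (.b :: w)) (x := 0)
            (by simp [wordTerm, HasCounts])
            (by simp_rw [wordTerm_b_b_cons]; exact hb.mul_left _)
            (by simp_rw [wordTerm_b_u_cons]; exact hu.mul_left _)
          convert h using 1
          rw [hnil, wordSumB_succ_zero, wordSumU]
          ring
        · have h := hasSum_of_cons (f := fun w => wordTerm (r + 1) (s + 1) t (.b :: w))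
            (by simp_rw [wordTerm_b_a_cons]; exact (total r s t (by omega)).mul_left _)
            (by simp_rw [wordTerm_b_b_cons]; exact hb.mul_left _)
            (by simp_rw [wordTerm_b_u_cons]; exact hu.mul_left _)
          convert h using 1
          rw [hnil, wordSumB_succ_succ, wordSumU]
          ring
    · obtain _ | t := t
      -- There are no such words, so the difference defining `wordSumU` has to vanish.
      · simp only [wordTerm, if_neg (not_hasCounts_u_cons _ _ _)]
        rw [wordSumU, wordSum_zero_right, wordTerm_nil]
        simp
      · obtain ⟨ha, hb, hu⟩ := ih (r + s + t) (by omega) r s t rfl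
        have hnil : wordTerm r s (t + 1) [.u] = wordTerm r s t [] := by
          have := wordTerm_eq_mul (k := 0) (hasCounts_u_cons r s t []) fun _ => rfl
          rwa [pow_zero, one_mul] at this
        have h := hasSum_of_cons (f := fun w => wordTerm r s (t + 1) (.u :: w))
          (by simp_rw [wordTerm_u_a_cons]; exact ha.mul_left _)
          (by simp_rw [wordTerm_u_b_cons]; exact hb.mul_left _)
          (by simp_rw [wordTerm_u_u_cons]; exact hu.mul_left _)
        convert h using 1
        rw [hnil, wordSumU, wordSumU, wordSum_succ_right, wordTerm_nil r s (t + 1),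
          if_neg (by simp)]
        ring

theorem hasSum_wordTerm (r s t : ℕ) : HasSum (wordTerm r s t) (wordSum r s t) := by
  obtain ⟨ha, hb, hu⟩ := hasSum_wordTerm_cons _ r s t rfl
  convert hasSum_of_cons ha hb hu using 1
  rw [wordSumU]; ring

/-! ### Overlines and excesses -/

/-- A part, given by its color, whether it is overlined, and the excess of its distance from the
following part over the minimal one. -/
abbrev Letter : Type := Color × Bool × ℕ

/-- The contribution of the overlines and of the excesses to the size of a sequence of letters, read
from the smallest part. -/
def slackSize : List Letter → ℕ
  | [] => 0
  | x :: d => (d.length + 1) * (x.2.1.toNat + x.2.2) + slackSize d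

/-- `q ^ slackSize d` if the first `t` letters of `d` are overlined, and `0` otherwise. -/
noncomputable def slackTerm (t : ℕ) (d : List Letter) : Series :=
  if ∀ x ∈ d.take t, x.2.1 = true then q ^ slackSize d else 0

theorem slackTerm_zero_cons (x : Letter) (d : List Letter) :
    slackTerm 0 (x :: d) =
      ((q ^ (d.length + 1)) ^ x.2.1.toNat * (q ^ (d.length + 1)) ^ x.2.2) * slackTerm 0 d := by
  simp [slackTerm, slackSize, pow_add, pow_mul, mul_add]

theorem slackTerm_succ_cons (t : ℕ) (x : Letter) (d : List Letter) :
    slackTerm (t + 1) (x :: d) =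
      ((if x.2.1 = true then q ^ (d.length + 1) else 0) * (q ^ (d.length + 1)) ^ x.2.2) *
        slackTerm t d := by
  obtain ⟨c, o, e⟩ := x
  cases o
  · simp [slackTerm]
  · rw [slackTerm, slackTerm, List.take_succ_cons, slackSize]
    simp only [List.forall_mem_cons, true_and, if_true, Bool.toNat_true]
    split_ifs <;> ring

/-- The sequences of letters with colors `c :: w`. -/
def fiberConsEquiv (c : Color) (w : List Color) :
    (Bool × ℕ) × {d : List Letter // d.map Prod.fst = w} ≃
      {d : List Letter // d.map Prod.fst = c :: w} where
  toFun p := ⟨(c, p.1) :: p.2.1, by simp [p.2.2]⟩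
  invFun
    | ⟨x :: d, h⟩ => (x.2, ⟨d, (List.cons.inj h).2⟩)
  left_inv _ := rfl
  right_inv
    | ⟨(c', p) :: d, h⟩ => by
      obtain rfl : c' = c := (List.cons.inj h).1
      rfl

theorem invPochQ_succ' (n : ℕ) :
    invPochQ (n + 1) = Ring.inverse (1 - q ^ (n + 1)) * invPochQ n := by
  rw [← invPochQ_succ n]
  linear_combination (-invPochQ (n + 1)) * Ring.inverse_mul_cancel _ (isUnit_one_sub_q_pow n)

theorem hasSum_geometric (n : ℕ) :
    HasSum (fun e : ℕ => (q ^ (n + 1)) ^ e) (Ring.inverse (1 - q ^ (n + 1))) := by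
  have h0 : MvPowerSeries.constantCoeff (q ^ (n + 1)) = 0 := by simp [constantCoeff_q]
  have h := (MvPowerSeries.WithPiTopology.summable_pow_of_constantCoeff_eq_zero h0).hasSum
  have h1 := MvPowerSeries.WithPiTopology.tsum_pow_mul_one_sub_of_constantCoeff_eq_zero h0
  convert h using 1
  linear_combination (-Ring.inverse (1 - q ^ (n + 1))) * h1 +
    (∑' e : ℕ, (q ^ (n + 1)) ^ e) * Ring.mul_inverse_cancel _ (isUnit_one_sub_q_pow n)

/-- The generating function of the overlines and excesses for a fixed sequence of colors. -/
theorem hasSum_slackTerm (w : List Color) (m t : ℕ) (hw : w.length = m + t) :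
    HasSum (fun d : {d : List Letter // d.map Prod.fst = w} => slackTerm t d.1)
      (q ^ (m * t + (t + 1).choose 2) * pochNegQ m * invPochQ (m + t)) := by
  induction w generalizing m t with
  | nil =>
    obtain ⟨rfl, rfl⟩ : m = 0 ∧ t = 0 := by simpa using hw.symm
    have h := hasSum_single
      (f := fun d : {d : List Letter // d.map Prod.fst = []} => slackTerm 0 d.1) ⟨[], rfl⟩
      fun d hd => absurd (Subtype.ext (List.map_eq_nil_iff.1 d.2)) hd
    simpa only [slackTerm, slackSize, List.take_nil, List.not_mem_nil, false_imp_iff,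
      implies_true, if_true, pow_zero, zero_mul, zero_add, Nat.choose_succ_self, pochNegQ_zero,
      invPochQ_zero, mul_one] using h
  | cons c w ih =>
    rw [← (fiberConsEquiv c w).hasSum_iff]
    have hlen : ∀ d : {d : List Letter // d.map Prod.fst = w}, d.1.length = w.length := fun d => by
      simpa using congrArg List.length d.2
    -- Raising the first letter raises all letters after it. Its excess gives a geometric series in
    -- q^(length); its overline gives 1 + q^(length) if free (t = 0), and q^(length) if forced.
    obtain _ | t := t
    · obtain ⟨m, rfl⟩ : ∃ m', m = m' + 1 := ⟨w.length, by simpa using hw.symm⟩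
      have hm : w.length = m := by simpa using hw
      have h := hasSum_mul_prod (hasSum_mul_prod
        (hasSum_fintype fun o : Bool => (q ^ (m + 1)) ^ o.toNat) (hasSum_geometric m))
        (ih m 0 hm)
      convert h using 1
      · funext p
        simp only [Function.comp, fiberConsEquiv, Equiv.coe_fn_mk, slackTerm_zero_cons, hlen, hm]
      · rw [Fintype.sum_bool]
        simp only [add_zero, invPochQ_succ', pochNegQ_succ, mul_zero]
        simp
        ring
    · have hm : w.length = m + t := by simp at hw; omega
      have h := hasSum_mul_prod (hasSum_mul_prod
        (hasSum_fintype fun o : Bool => if o = true then q ^ (m + t + 1) else 0)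
        (hasSum_geometric (m + t))) (ih m t hm)
      convert h using 1
      · funext p
        simp only [Function.comp, fiberConsEquiv, Equiv.coe_fn_mk, slackTerm_succ_cons, hlen, hm]
      · rw [Fintype.sum_bool, ← add_assoc, invPochQ_succ', Nat.choose_succ_succ' (t + 1) 1,
          Nat.choose_one_right]
        simp only [if_true, Bool.false_eq_true, if_false, add_zero]
        ring

/-! ### Summation over all sequences of letters -/

/-- The monomial of a sequence of letters whose first `t` letters are overlined, where `t` is the
number of letters colored `u`, and `0` for all other sequences. -/
noncomputable def letterTerm (d : List Letter) : Series :=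
  a ^ (d.map Prod.fst).count .a * b ^ (d.map Prod.fst).count .b * wordPow (d.map Prod.fst) *
    slackTerm ((d.map Prod.fst).count .u) d

theorem hasSum_letterTerm_fiber (w : List Color) :
    HasSum (fun d : {d : List Letter // d.map Prod.fst = w} => letterTerm d.1)
      (a ^ w.count .a * b ^ w.count .b * wordPow w *
        (q ^ ((w.count .a + w.count .b) * w.count .u + (w.count .u + 1).choose 2) *
          pochNegQ (w.count .a + w.count .b) *
          invPochQ (w.count .a + w.count .b + w.count .u))) := by
  refine ((hasSum_slackTerm w _ _ (length_eq_count_add w)).mul_left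
    (a ^ w.count .a * b ^ w.count .b * wordPow w)).congr_fun fun d => ?_
  rw [letterTerm, d.2]

theorem hasSum_of_fibers {α β : Type*} (k : α → β) {f : α → Series} {g : β → Series} {v : Series}
    (hf : HasSum f v) (hg : ∀ y, HasSum (fun x : {x // k x = y} => f x) (g y)) : HasSum g v :=
  HasSum.sigma ((Equiv.sigmaFiberEquiv k).hasSum_iff.2 hf) hg

theorem hasSum_wordPow_fiber (r s t : ℕ) :
    HasSum (fun w : {w : List Color // ((w.count .a, w.count .b), w.count .u) = ((r, s), t)} =>
      wordPow w) (wordSum r s t) := by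
  have h := (hasSum_subtype_iff_of_support_subset
    (s := {w : List Color | ((w.count .a, w.count .b), w.count .u) = ((r, s), t)})
    (fun w hw => ?_)).2 (hasSum_wordTerm r s t)
  · refine h.congr_fun fun w => ?_
    have hw := w.2
    simp only [Set.mem_ofPred_eq, Prod.mk.injEq, and_assoc] at hw
    exact (if_pos hw).symm
  · by_contra hc
    refine hw (if_neg ?_)
    simpa [HasCounts, and_assoc] using hc

/-- Euler's series at q^n is the tail (-q^(n+1))_∞, which `pochNegQ n` completes; the result no
longer depends on n. -/
theorem pochNegQ_mul_hasSum_eulerTerm (n : ℕ) :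
    HasSum (fun t => pochNegQ n * eulerTerm (q ^ n) t) (qPochInf (-q) q) := by
  have h := tsum_eulerTerm_eq_prod_mul 1 n
  simp only [one_mul] at h
  rw [(hasSum_eulerTerm 1).tsum_eq, one_mul] at h
  rw [h]
  exact (summable_eulerTerm _).hasSum.mul_left _

theorem hasSum_letterTerm (h : Summable letterTerm) :
    HasSum letterTerm (qPochInf (-q) q * qPochInf (-(a * q)) q * qPochInf (-(b * q)) q *
      Ring.inverse (qPochInf (a * b * q) (q ^ 2))) := by
  have h1 := hasSum_of_fibers (fun d : List Letter => d.map Prod.fst) h.hasSum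
    hasSum_letterTerm_fiber
  have h2 := hasSum_of_fibers (fun w : List Color => ((w.count .a, w.count .b), w.count .u)) h1
    (g := fun p => a ^ p.1.1 * b ^ p.1.2 * wordSum p.1.1 p.1.2 p.2 *
      (q ^ ((p.1.1 + p.1.2) * p.2 + (p.2 + 1).choose 2) * pochNegQ (p.1.1 + p.1.2) *
        invPochQ (p.1.1 + p.1.2 + p.2))) (by
      rintro ⟨⟨r, s⟩, t⟩
      refine (((hasSum_wordPow_fiber r s t).mul_left (a ^ r * b ^ s)).mul_right
        (q ^ ((r + s) * t + (t + 1).choose 2) * pochNegQ (r + s) *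
          invPochQ (r + s + t))).congr_fun fun w => ?_
      obtain ⟨w, hw⟩ := w
      simp only [Prod.mk.injEq] at hw
      rw [hw.1.1, hw.1.2, hw.2])
  have h3 := h2.prod_fiberwise (g := fun p => pairTerm a b p * qPochInf (-q) q) (by
      rintro ⟨r, s⟩
      refine ((pochNegQ_mul_hasSum_eulerTerm (r + s)).mul_left
        (pairTerm a b (r, s))).congr_fun fun t => ?_
      simp only [pairTerm, pairCoeff, wordSum, eulerTerm]
      rw [← pow_mul]
      linear_combination a ^ r * b ^ s * q ^ minExponent r s * pochNegQ (r + s) * invPochSq r *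
        invPochSq s * invPochQ t * q ^ ((r + s) * t + (t + 1).choose 2) * pochNegQ (r + s) *
        pochQ_mul_inv (r + s + t))
  have h4 := (hasSum_pairTerm a b).mul_right (qPochInf (-q) q)
  have h5 := h.hasSum
  rw [h3.unique h4] at h5
  convert h5 using 1
  ring

/-! ### Jagged overpartitions as free sequences of letters -/

/-- The difference condition for a part `x` followed by a part `y`. -/
def DiffCond (x y : Part) : Prop :=
  minDiff x.overlined x.color y.color ≤ (x.size : ℤ) - (y.size : ℤ)

/-- The part with respect to which the difference condition says that a part is admissible as the
last part. -/
def zeroPart : Part := ⟨0, .a, false⟩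

/-- The parts of color `b` and the overlined parts are positive. -/
def Part.IsValid (x : Part) : Prop :=
  (x.color = .b → 1 ≤ x.size) ∧ (x.overlined = true → 1 ≤ x.size)

theorem isValid_zeroPart : zeroPart.IsValid := by simp [zeroPart, Part.IsValid]

theorem minDiff_true (c c' : Color) : minDiff true c c' = minDiff false c c' + 1 := by
  cases c <;> cases c' <;> rfl

theorem minDiff_eq (o : Bool) (c c' : Color) : minDiff o c c' = minDiff false c c' + o.toNat := by
  cases o
  · simp
  · simp [minDiff_true]

/-- The only negative entries are -1, in the columns of b, and a valid b is at least 1. This makes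
the `toNat` in `partsOfLetters` harmless. -/
theorem Part.IsValid.nonneg {y : Part} (hy : y.IsValid) (o : Bool) (c : Color) :
    0 ≤ (y.size : ℤ) + minDiff o c y.color := by
  obtain ⟨n, c', o'⟩ := y
  have h := hy.1
  cases o <;> cases c <;> cases c' <;> simp [minDiff] at * <;> omega

theorem DiffCond.isValid {x y : Part} (h : DiffCond x y) (hy : y.IsValid) : x.IsValid := by
  obtain ⟨n, c, o⟩ := x
  obtain ⟨n', c', o'⟩ := y
  have h := hy.1
  unfold DiffCond Part.IsValid at *
  cases o <;> cases c <;> cases c' <;> simp [minDiff] at * <;> omega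

/-- A sequence of parts, read from the smallest part, satisfies the difference conditions. -/
abbrev RevChain (l : List Part) : Prop := l.IsChain fun y x => DiffCond x y

theorem RevChain.isValid {y : Part} {l : List Part} (h : RevChain (y :: l)) (hy : y.IsValid) :
    ∀ x ∈ l, x.IsValid := by
  induction l generalizing y with
  | nil => simp
  | cons x l ih =>
    rw [RevChain, List.isChain_cons_cons] at h
    have hx := h.1.isValid hy
    exact List.forall_mem_cons.2 ⟨hx, ih h.2 hx⟩

/-- The height of a color, whose differences bound the minimal distances from below. -/
def Color.height : Color → ℤ
  | .a => 1
  | .b => 2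
  | .u => 0

theorem height_sub_le_minDiff (o : Bool) (c c' : Color) :
    c.height - c'.height + o.toNat ≤ minDiff o c c' := by
  cases o <;> cases c <;> cases c' <;> simp [minDiff, Color.height]

/-- Size minus height decreases weakly along the sequence, and strictly after an overlined part, so
the size and color of an overlined part cannot recur later. -/
theorem pairwise_final_of_isChain {l : List Part} (h : l.IsChain DiffCond) :
    l.Pairwise fun x y => x.overlined = true → ¬ (y.size = x.size ∧ y.color = x.color) := by
  let Q : Part → Part → Prop := fun x y =>
    (y.size : ℤ) - y.color.height + x.overlined.toNat ≤ x.size - x.color.height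
  have hQ : ∀ x y, DiffCond x y → Q x y := fun x y hxy => by
    have := height_sub_le_minDiff x.overlined x.color y.color
    simp only [DiffCond, Q] at *
    linarith
  have : Trans Q Q Q := ⟨fun {x y z} h1 h2 => by
    simp only [Q] at *
    have : (0 : ℤ) ≤ y.overlined.toNat := by positivity
    linarith⟩
  refine ((h.imp hQ).pairwise).imp fun {x y} hxy ho => ?_
  rintro ⟨h1, h2⟩
  simp only [Q, h1, h2, ho, Bool.toNat_true] at hxy
  push_cast at hxy
  linarith

theorem diffCond_zeroPart_iff (x : Part) : DiffCond x zeroPart ↔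
    (x.overlined = true → 0 < x.size) ∧
      x ∉ ([⟨0, .a, false⟩, ⟨0, .b, false⟩, ⟨1, .a, true⟩, ⟨1, .b, true⟩] : List Part) := by
  obtain ⟨n, c, o⟩ := x
  cases o <;> cases c <;> simp [DiffCond, minDiff, zeroPart] <;> omega

theorem isJagged_iff (l : List Part) : IsJagged l ↔ RevChain (zeroPart :: l.reverse) := by
  have hrev : RevChain l.reverse ↔ l.IsChain DiffCond := List.isChain_reverse
  rw [RevChain, List.isChain_cons, ← RevChain, List.head?_reverse, hrev]
  constructor
  · intro h
    refine ⟨fun x hx => (diffCond_zeroPart_iff x).2 ⟨?_, h.last x hx⟩, h.diff⟩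
    exact h.pos_of_overlined x (List.mem_of_getLast? hx)
  · rintro ⟨h1, h2⟩
    have hc : RevChain (zeroPart :: l.reverse) := by
      rw [RevChain, List.isChain_cons, ← RevChain, List.head?_reverse, hrev]
      exact ⟨h1, h2⟩
    exact ⟨h2, fun x hx => (hc.isValid isValid_zeroPart x (List.mem_reverse.2 hx)).2,
      pairwise_final_of_isChain h2, fun x hx => ((diffCond_zeroPart_iff x).1 (h1 x hx)).2⟩

/-- The sequence of parts, read from the smallest part, that follows the part `y` and has the given
letters. -/
def partsOfLetters : Part → List Letter → List Part
  | _, [] => []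
  | y, (c, o, e) :: d =>
    let x : Part := ⟨((y.size : ℤ) + minDiff o c y.color + e).toNat, c, o⟩
    x :: partsOfLetters x d

/-- The letters of a sequence of parts, read from the smallest part, that follows the part `y`. -/
def lettersOfParts : Part → List Part → List Letter
  | _, [] => []
  | y, x :: l => (x.color, x.overlined,
      ((x.size : ℤ) - y.size - minDiff x.overlined x.color y.color).toNat) :: lettersOfParts x l

theorem partsOfLetters_lettersOfParts {y : Part} {l : List Part} (h : RevChain (y :: l)) :
    partsOfLetters y (lettersOfParts y l) = l := by
  induction l generalizing y with
  | nil => rfl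
  | cons x l ih =>
    rw [RevChain, List.isChain_cons_cons] at h
    have hx : (⟨((y.size : ℤ) + minDiff x.overlined x.color y.color +
        (((x.size : ℤ) - y.size - minDiff x.overlined x.color y.color).toNat : ℕ)).toNat,
        x.color, x.overlined⟩ : Part) = x := by
      have := h.1
      unfold DiffCond at this
      obtain ⟨n, c, o⟩ := x
      simp only [Part.mk.injEq, and_true] at *
      omega
    simp only [lettersOfParts, partsOfLetters, hx, ih h.2]

theorem diffCond_next {y : Part} (hy : y.IsValid) (c : Color) (o : Bool) (e : ℕ) :
    DiffCond ⟨((y.size : ℤ) + minDiff o c y.color + e).toNat, c, o⟩ y := by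
  have := hy.nonneg o c
  simp only [DiffCond]
  omega

theorem revChain_partsOfLetters {y : Part} (hy : y.IsValid) (d : List Letter) :
    RevChain (y :: partsOfLetters y d) := by
  induction d generalizing y with
  | nil => exact List.isChain_singleton _
  | cons x d ih =>
    obtain ⟨c, o, e⟩ := x
    have hx := diffCond_next hy c o e
    exact List.isChain_cons_cons.2 ⟨hx, ih (hx.isValid hy)⟩

theorem lettersOfParts_partsOfLetters {y : Part} (hy : y.IsValid) (d : List Letter) :
    lettersOfParts y (partsOfLetters y d) = d := by
  induction d generalizing y with
  | nil => rfl
  | cons x d ih =>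
    obtain ⟨c, o, e⟩ := x
    have hx := diffCond_next hy c o e
    have := hy.nonneg o c
    simp only [partsOfLetters, lettersOfParts, ih (hx.isValid hy), List.cons.injEq, Prod.mk.injEq,
      true_and, and_true]
    omega

/-- Each difference is counted once for its own part and once for every larger part, and the base
size once for all parts. -/
theorem sum_size_partsOfLetters {y : Part} (hy : y.IsValid) (d : List Letter) :
    (((partsOfLetters y d).map Part.size).sum : ℤ) =
      d.length * y.size + wordSize y.color (d.map Prod.fst) + slackSize d := by
  induction d generalizing y with
  | nil => simp [partsOfLetters, wordSize, slackSize]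
  | cons x d ih =>
    obtain ⟨c, o, e⟩ := x
    have hx := diffCond_next hy c o e
    have h0 := hy.nonneg o c
    have h1 := ih (hx.isValid hy)
    simp only [partsOfLetters, List.map_cons, List.sum_cons, Nat.cast_add, wordSize, slackSize,
      List.length_cons, List.length_map, Nat.cast_mul, Nat.cast_one]
    rw [h1, Int.toNat_of_nonneg (by omega), minDiff_eq]
    ring

theorem map_color_partsOfLetters (y : Part) (d : List Letter) :
    (partsOfLetters y d).map Part.color = d.map Prod.fst := by
  induction d generalizing y with
  | nil => rfl
  | cons x d ih => simp [partsOfLetters, ih]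

theorem map_overlined_partsOfLetters (y : Part) (d : List Letter) :
    (partsOfLetters y d).map Part.overlined = d.map fun x => x.2.1 := by
  induction d generalizing y with
  | nil => rfl
  | cons x d ih => simp [partsOfLetters, ih]

/-- The jagged overpartition with the given letters. -/
def decode (d : List Letter) : List Part := (partsOfLetters zeroPart d).reverse

/-- The letters of a jagged overpartition. -/
def encode (l : List Part) : List Letter := lettersOfParts zeroPart l.reverse

theorem isJagged_decode (d : List Letter) : IsJagged (decode d) := by
  rw [isJagged_iff, decode, List.reverse_reverse]
  exact revChain_partsOfLetters isValid_zeroPart d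

theorem encode_decode (d : List Letter) : encode (decode d) = d := by
  rw [encode, decode, List.reverse_reverse]
  exact lettersOfParts_partsOfLetters isValid_zeroPart d

theorem decode_encode {l : List Part} (h : IsJagged l) : decode (encode l) = l := by
  rw [encode, decode, partsOfLetters_lettersOfParts ((isJagged_iff l).1 h), List.reverse_reverse]

theorem numColor_eq_count (c : Color) (l : List Part) :
    numColor c l = (l.map Part.color).count c := by
  rw [numColor, List.count, List.countP_map]
  congr 1

theorem numColor_decode (c : Color) (d : List Letter) :
    numColor c (decode d) = (d.map Prod.fst).count c := by
  rw [numColor_eq_count, decode, List.map_reverse, List.count_reverse, map_color_partsOfLetters]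

theorem sum_size_decode (d : List Letter) :
    ((decode d).map Part.size).sum = (wordSize .a (d.map Prod.fst)).toNat + slackSize d := by
  have h := sum_size_partsOfLetters isValid_zeroPart d
  have h0 := wordSize_nonneg (d.map Prod.fst)
  rw [decode, List.map_reverse, List.sum_reverse]
  simp only [zeroPart, Nat.cast_zero, mul_zero, zero_add] at *
  omega

theorem finalUOverlined_decode (d : List Letter) : FinalUOverlined (decode d) ↔
    ∀ x ∈ d.take ((d.map Prod.fst).count .u), x.2.1 = true := by
  have hlen : (partsOfLetters zeroPart d).length = d.length := by
    simpa using congrArg List.length (map_color_partsOfLetters zeroPart d)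
  have hle : (d.map Prod.fst).count .u ≤ d.length := by
    simpa using List.count_le_length (a := Color.u) (l := d.map Prod.fst)
  have hmap : ∀ t, (∀ x ∈ (partsOfLetters zeroPart d).take t, x.overlined = true) ↔
      ∀ o ∈ ((partsOfLetters zeroPart d).map Part.overlined).take t, o = true := fun t => by
    rw [← List.map_take, List.forall_mem_map]
  rw [FinalUOverlined, numColor_decode, decode, List.drop_reverse, List.length_reverse, hlen,
    Nat.sub_sub_self hle]
  simp only [List.mem_reverse]
  rw [hmap, map_overlined_partsOfLetters, ← List.map_take, List.forall_mem_map]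

theorem letterTerm_eq (d : List Letter) [Decidable (FinalUOverlined (decode d))] :
    letterTerm d = if FinalUOverlined (decode d) then
      a ^ numColor .a (decode d) * b ^ numColor .b (decode d) *
        q ^ ((decode d).map Part.size).sum else 0 := by
  rw [letterTerm, slackTerm, wordPow, numColor_decode, numColor_decode, sum_size_decode]
  simp only [finalUOverlined_decode]
  split_ifs
  · rw [pow_add]; ring
  · rw [mul_zero]

/-! ### Finiteness and comparison with the counting numbers -/

/-- The jagged overpartitions of `n` with `i` parts colored `a` and `j` parts colored `b` whose
final parts are overlined, for as many parts as there are parts colored `u`. -/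
def jaggedUnion (n i j : ℕ) : Set (List Part) :=
  {l | IsJagged l ∧ FinalUOverlined l ∧ (l.map Part.size).sum = n ∧
    numColor .a l = i ∧ numColor .b l = j}

theorem finite_jaggedUnion (n i j : ℕ) : (jaggedUnion n i j).Finite := by
  let g : Fin (n + 1) × Color × Bool → Part := fun x => ⟨x.1, x.2.1, x.2.2⟩
  have : Finite Color := Set.finite_univ_iff.1
    (({.a, .b, .u} : Finset Color).finite_toSet.subset fun c _ => by cases c <;> simp)
  refine ((List.finite_length_le _ (i + j + n)).image (List.map g)).subset ?_
  rintro l ⟨h, hF, hsum, hi, hj⟩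
  have hle : ∀ x ∈ l, x.size < n + 1 := fun x hx => by
    have := List.le_sum_of_mem (List.mem_map_of_mem (f := Part.size) hx)
    omega
  have hlen : l.length = i + j + numColor .u l := by
    rw [← hi, ← hj]
    simpa [numColor_eq_count] using length_eq_count_add (l.map Part.color)
  -- Parts `0_u` could otherwise repeat without bound; here the final t parts are overlined, hence
  -- positive, so t ≤ n.
  have hu : numColor .u l ≤ n := by
    have h1 : ∀ k ∈ (l.drop (l.length - numColor .u l)).map Part.size, 1 ≤ k := by
      rw [List.forall_mem_map]
      exact fun x hx => h.pos_of_overlined x (List.mem_of_mem_drop hx) (hF x hx)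
    have h2 := List.length_le_sum_of_one_le _ h1
    have h3 := List.Sublist.sum_le_sum
      ((List.drop_sublist (l.length - numColor .u l) l).map Part.size) fun _ _ => Nat.zero_le _
    simp only [List.length_map, List.length_drop] at h2
    omega
  refine ⟨l.pmap (fun x hx => (⟨x.size, hx⟩, x.color, x.overlined)) hle, ?_, ?_⟩
  · simp only [Set.mem_ofPred_eq, List.length_pmap]
    omega
  · rw [List.map_pmap]
    exact (List.pmap_eq_map hle).trans (List.map_id l)

theorem finite_jaggedSet (n k i j : ℕ) : (jaggedSet n k i j).Finite :=
  (finite_jaggedUnion n i j).subset fun _ h => ⟨h.1, h.2.1, h.2.2.1, h.2.2.2.2⟩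

theorem eq_of_coeff_ne_zero {i j n : ℕ} {m : Var →₀ ℕ}
    (h : MvPowerSeries.coeff m (a ^ i * b ^ j * q ^ n) ≠ 0) :
    m Var.q = n ∧ m Var.a = i ∧ m Var.b = j := by
  rw [a, b, q, MvPowerSeries.X_pow_eq, MvPowerSeries.X_pow_eq, MvPowerSeries.X_pow_eq,
    MvPowerSeries.monomial_mul_monomial, MvPowerSeries.monomial_mul_monomial,
    MvPowerSeries.coeff_monomial] at h
  have hm := of_not_not fun hc => h (if_neg hc)
  simp [hm]

theorem summable_letterTerm : Summable letterTerm := by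
  classical
  rw [summable_iff_finite_coeff]
  intro m
  refine ((finite_jaggedUnion (m Var.q) (m Var.a) (m Var.b)).preimage
    (Function.LeftInverse.injective encode_decode).injOn).subset fun d hd => ?_
  rw [Set.mem_ofPred_eq, letterTerm_eq] at hd
  split_ifs at hd with hF
  · obtain ⟨h1, h2, h3⟩ := eq_of_coeff_ne_zero hd
    exact ⟨isJagged_decode d, hF, h1.symm, h2.symm, h3.symm⟩
  · simp at hd

/-- The statistics by which jagged overpartitions are counted. -/
def stats (l : List Part) : ℕ × ℕ × ℕ × ℕ :=
  ((l.map Part.size).sum, numNonOverlined l, numColor .a l, numColor .b l)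

/-- In this fiber the nonzero terms are the encodings of `jaggedSet n k i j`, and all of them are
the same monomial. -/
theorem hasSum_letterTerm_stats (n k i j : ℕ) :
    HasSum (fun d : {d : List Letter // stats (decode d) = (n, k, i, j)} => letterTerm d)
      ((cBar3 n k i j : Series) * a ^ i * b ^ j * q ^ n) := by
  classical
  have hmem : ∀ l ∈ jaggedSet n k i j, stats l = (n, k, i, j) := fun l hl => by
    obtain ⟨-, -, h1, h2, h3, h4⟩ := hl
    rw [stats, h1, h2, h3, h4]
  let φ : jaggedSet n k i j → {d : List Letter // stats (decode d) = (n, k, i, j)} := fun l =>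
    ⟨encode l, by rw [decode_encode l.2.1]; exact hmem l l.2⟩
  have hφ : Function.Injective φ := fun l l' h => by
    have := congrArg (fun d => decode d.1) h
    simp only [φ, decode_encode l.2.1, decode_encode l'.2.1] at this
    exact Subtype.ext this
  refine (hφ.hasSum_iff fun d hd => ?_).1 ?_
  · rw [letterTerm_eq, if_neg]
    intro hF
    have hs := d.2
    simp only [stats, Prod.mk.injEq] at hs
    exact hd ⟨⟨decode d, isJagged_decode d, hF, hs⟩, Subtype.ext (encode_decode d)⟩
  · have : Fintype (jaggedSet n k i j) := (finite_jaggedSet n k i j).fintype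
    have h := hasSum_fintype fun _ : jaggedSet n k i j => (a ^ i * b ^ j * q ^ n : Series)
    rw [sum_const, card_univ, ← Nat.card_eq_fintype_card, Nat.card_coe_set_eq, ← cBar3,
      nsmul_eq_mul, ← mul_assoc, ← mul_assoc] at h
    refine h.congr_fun fun l => ?_
    obtain ⟨h0, hF, h1, -, h3, h4⟩ := l.2
    simp only [Function.comp, φ]
    rw [letterTerm_eq, decode_encode h0, if_pos hF, h1, h3, h4]

end Capparelli

open Capparelli in
theorem mainTheorem6 :
    (∀ n k i j : ℕ, (jaggedSet n k i j).Finite) ∧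
    HasSum
      (fun p : ℕ × ℕ × ℕ × ℕ =>
        match p with
        | (n, k, i, j) => (cBar3 n k i j : Series) * a ^ i * b ^ j * q ^ n)
      (qPochInf (-q) q * qPochInf (-(a * q)) q * qPochInf (-(b * q)) q *
        Ring.inverse (qPochInf (a * b * q) (q ^ 2))) := by
  refine ⟨finite_jaggedSet, hasSum_of_fibers (fun d => stats (decode d))
    (hasSum_letterTerm summable_letterTerm) ?_⟩
  rintro ⟨n, k, i, j⟩
  exact hasSum_letterTerm_stats n k i j
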